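/- Let $d\ge 0$ be an integer, let $p_1=2<p_2=3<\cdots<p_d$ be the first $d$ primes, and put $\xi^* := \tfrac1\pi(\sqrt{p_1},\sqrt{p_2},\dots,\sqrt{p_d})\in\mathbb{R}^d$. For a finite set $S\subset\mathbb{Z}^d$ let $\sigma_S(\xi):=\sum_{n\in S}e^{2\pi i\langle n,\xi\rangle}$ for $\xi\in\mathbb{R}^d$, and for a polytope $\mathcal{P}\subset\mathbb{R}^d$ (the convex hull of a finite set of points) let $\sigma_{\mathcal P}(\xi):=\sum_{n\in\mathbb{Z}^d\cap\mathcal P}e^{2\pi i\langle n,\xi\rangle}$. A polytope is called integer (resp. rational) if all coordinates of all its vertices are integers (resp. rational numbers); it need not be full-dimensional. Then: 1. For all finite sets $A,B\subset\mathbb{Z}^d$: $\ \sigma_A(\xi^*)=\sigma_B(\xi^*)\iff A=B$. 2. For all integer polytopes $\mathcal P,\mathcal Q\subset\mathbb{R}^d$: $\ \sigma_{\mathcal P}(\xi^*)=\sigma_{\mathcal Q}(\xi^*)\iff \mathcal P=\mathcal Q$. 3. For all rational polytopes $\mathcal P,\mathcal Q\subset\mathbb{R}^d$ and every integer $k>0$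 such that $k\mathcal P$ and $k\mathcal Q$ are both integer polytopes: $\ \sigma_{k\mathcal P}(\xi^*)=\sigma_{k\mathcal Q}(\xi^*)\iff \mathcal P=\mathcal Q$. -/

import Mathlib

open scoped Pointwise

namespace IntegerPoint

/-- The integer vector `n ∈ ℤ^d`, seen as a point of `ℝ^d`. -/
noncomputable def toReal {d : ℕ} (n : Fin d → ℤ) : EuclideanSpace ℝ (Fin d) :=
  WithLp.toLp 2 (fun i => (n i : ℝ))

/-- The set `ℤ^d ∩ P` of integer points of `P ⊆ ℝ^d`. -/
def integerPoints {d : ℕ} (P : Set (EuclideanSpace ℝ (Fin d))) : Set (Fin d → ℤ) :=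
  {n | toReal n ∈ P}

/-- The integer point transform `σ_S(ξ) = ∑_{n ∈ S} e^{2πi⟨n, ξ⟩}` of a finite set `S ⊆ ℤ^d`. -/
noncomputable def sigma {d : ℕ} (S : Finset (Fin d → ℤ)) (ξ : EuclideanSpace ℝ (Fin d)) : ℂ :=
  ∑ n ∈ S, Complex.exp (2 * Real.pi * Complex.I * ((inner ℝ (toReal n) ξ : ℝ) : ℂ))

/-- The integer point transform `σ_P(ξ) = ∑_{n ∈ ℤ^d ∩ P} e^{2πi⟨n, ξ⟩}` of a set `P ⊆ ℝ^d` with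
finitely many integer points; every polytope is one, see `IsPolytope.finite_integerPoints`. -/
noncomputable def sigmaPolytope {d : ℕ} (P : Set (EuclideanSpace ℝ (Fin d)))
    (ξ : EuclideanSpace ℝ (Fin d)) : ℂ :=
  ∑ᶠ n ∈ integerPoints P,
    Complex.exp (2 * Real.pi * Complex.I * ((inner ℝ (toReal n) ξ : ℝ) : ℂ))

/-- A (convex) polytope: the convex hull of a finite set of points. -/
def IsPolytope {d : ℕ} (P : Set (EuclideanSpace ℝ (Fin d))) : Prop :=
  ∃ s : Finset (EuclideanSpace ℝ (Fin d)), P = convexHull ℝ (s : Set (EuclideanSpace ℝ (Fin d)))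

/-- An integer polytope: all coordinates of all vertices (extreme points) are integers. -/
def IsIntegerPolytope {d : ℕ} (P : Set (EuclideanSpace ℝ (Fin d))) : Prop :=
  IsPolytope P ∧ ∀ v ∈ P.extremePoints ℝ, ∀ i, ∃ m : ℤ, v i = (m : ℝ)

/-- A rational polytope: all coordinates of all vertices (extreme points) are rational. -/
def IsRationalPolytope {d : ℕ} (P : Set (EuclideanSpace ℝ (Fin d))) : Prop :=
  IsPolytope P ∧ ∀ v ∈ P.extremePoints ℝ, ∀ i, ∃ q : ℚ, v i = (q : ℝ)

/-- The point `ξ* = (1/π)(√2, √3, √5, …, √p_d)`, with `p_1 < … < p_d` the first `d` primes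
(`Nat.nth Nat.Prime` counts from `0`, so that `Nat.nth Nat.Prime 0 = 2`). -/
noncomputable def xiStar (d : ℕ) : EuclideanSpace ℝ (Fin d) :=
  (1 / Real.pi) • WithLp.toLp 2 (fun i : Fin d => Real.sqrt (Nat.nth Nat.Prime (i : ℕ) : ℝ))

theorem IsPolytope.finite_integerPoints {d : ℕ} {P : Set (EuclideanSpace ℝ (Fin d))}
    (hP : IsPolytope P) : (integerPoints P).Finite := by
  obtain ⟨s, rfl⟩ := hP
  have hb : Bornology.IsBounded (convexHull ℝ (s : Set (EuclideanSpace ℝ (Fin d)))) :=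
    isBounded_convexHull.2 s.finite_toSet.isBounded
  obtain ⟨R, hR⟩ := hb.exists_norm_le
  refine (Set.finite_Icc (fun _ : Fin d => -⌈R⌉) (fun _ => ⌈R⌉)).subset ?_
  intro n hn
  have key : ∀ i, |n i| ≤ ⌈R⌉ := by
    intro i
    have h1 : ‖(toReal n) i‖ ≤ ‖toReal n‖ := PiLp.norm_apply_le _ i
    have h2 : |(n i : ℝ)| ≤ R := h1.trans (hR _ hn)
    have h3 := h2.trans (Int.le_ceil R)
    exact_mod_cast h3
  exact ⟨fun i => (abs_le.1 (key i)).1, fun i => (abs_le.1 (key i)).2⟩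

end IntegerPoint

/-!
Put `β j = 2 i √p_j` and, for `n ∈ ℤ^d`, `α n = ∑ j, n j * β j`. Then `σ_A(ξ*) = ∑ n ∈ A, exp (α n)`,
so the first claim says that a relation `∑ a n * exp (α n) = 0` with integers `a n` is trivial. This
is the case of the Lindemann–Weierstrass theorem for the exponents `α n`, which are pairwise distinct
because square roots of distinct primes are linearly independent over `ℚ`
(`eq_zero_of_sum_mul_sqrt_prime_eq_zero`).

Mathlib has the analytic half of Lindemann–Weierstrass
(`LindemannWeierstrass.exp_polynomial_approx`). The arithmetic half needs no Galois theory here,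
because the conjugates of `α n` are the `α (ε • n)` with `ε ∈ {±1}^d`, and all of these lie on the
lattice `α(ℤ^d)`. So relations are elements `a` of the group ring `ℤ[ℤ^d]` on which the evaluation
homomorphism `n ↦ exp (α n)` vanishes. If `a ≠ 0`, the product `F` of its images under all sign
changes is a nonzero sign-invariant relation, since `ℤ[ℤ^d]` is a domain. The constant coefficient of
`F * F` is `∑ F n * F (-n) = ∑ (F n) ^ 2 > 0` (`eq_zero_of_sum_mul_exp_eq_zero`).

A sign-invariant relation with nonzero constant coefficient is impossible
(`sum_mul_exp_ne_zero_of_invariant`). The analytic estimate replaces each `exp (α n)`, `n ≠ 0`, by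
`(p / N) * g (α n)` with `g ∈ ℤ[X]`, for a large prime `p ∤ N`. The sum `∑ a n * g (α n)` is an
integer: it is the value at `β` of a sign-invariant polynomial in `ℤ[x_1, …, x_d]`, hence of one with
only even exponents, and the `(β j) ^ 2` are integers (`exists_sum_mul_aeval_eq_intCast`). This
yields an integer of absolute value less than `1` that is not divisible by `p`.

The claims on polytopes reduce to the first one: an integer polytope is the closed convex hull of its
vertices, which are among its integer points, so it is determined by them. Scaling by `k ≠ 0` is
injective on sets, which settles rational polytopes.
-/

/-! ### Linear independence of square roots of primes -/

/-- Adjoining to a subfield `K` of `ℝ` a square root `s` of one of its elements gives `K + K s`. -/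
theorem Subfield.exists_le_quadratic (K : Subfield ℝ) {s : ℝ} (hs : s ^ 2 ∈ K) :
    ∃ L : Subfield ℝ, K ≤ L ∧ s ∈ L ∧ ∀ x ∈ L, ∃ a ∈ K, ∃ b ∈ K, x = a + b * s := by
  by_cases hsK : s ∈ K
  · exact ⟨K, le_rfl, hsK, fun x hx => ⟨x, hx, 0, K.zero_mem, by ring⟩⟩
  let L : Subfield ℝ :=
    { carrier := {x | ∃ a ∈ K, ∃ b ∈ K, x = a + b * s}
      zero_mem' := ⟨0, K.zero_mem, 0, K.zero_mem, by ring⟩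
      one_mem' := ⟨1, K.one_mem, 0, K.zero_mem, by ring⟩
      add_mem' := by
        rintro _ _ ⟨a, ha, b, hb, rfl⟩ ⟨a', ha', b', hb', rfl⟩
        exact ⟨a + a', K.add_mem ha ha', b + b', K.add_mem hb hb', by ring⟩
      neg_mem' := by
        rintro _ ⟨a, ha, b, hb, rfl⟩
        exact ⟨-a, K.neg_mem ha, -b, K.neg_mem hb, by ring⟩
      mul_mem' := by
        rintro _ _ ⟨a, ha, b, hb, rfl⟩ ⟨a', ha', b', hb', rfl⟩
        exact ⟨a * a' + b * b' * s ^ 2,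
          K.add_mem (K.mul_mem ha ha') (K.mul_mem (K.mul_mem hb hb') hs), a * b' + b * a',
          K.add_mem (K.mul_mem ha hb') (K.mul_mem hb ha'), by ring⟩
      inv_mem' := by
        rintro _ ⟨a, ha, b, hb, rfl⟩
        have hN : a ^ 2 - b ^ 2 * s ^ 2 ∈ K :=
          K.sub_mem (K.pow_mem ha 2) (K.mul_mem (K.pow_mem hb 2) hs)
        refine ⟨a / (a ^ 2 - b ^ 2 * s ^ 2), K.div_mem ha hN,
          -b / (a ^ 2 - b ^ 2 * s ^ 2), K.div_mem (K.neg_mem hb) hN, ?_⟩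
        by_cases hb0 : b = 0
        · subst hb0
          by_cases ha0 : a = 0
          · simp [ha0]
          · simp only [zero_mul, add_zero]
            field_simp
            ring
        · have hm : a - b * s ≠ 0 := by
            intro h
            apply hsK
            have : s = a / b := by field_simp; linarith
            rw [this]
            exact K.div_mem ha hb
          have hp : a + b * s ≠ 0 := by
            intro h
            apply hsK
            have : s = -a / b := by field_simp; linarith
            rw [this]
            exact K.div_mem (K.neg_mem ha) hb
          have : a ^ 2 - b ^ 2 * s ^ 2 = (a + b * s) * (a - b * s) := by ring
          rw [this]
          field_simp
          ring }
  refine ⟨L, fun x hx => ⟨x, hx, 0, K.zero_mem, by ring⟩, ⟨0, K.zero_mem, 1, K.one_mem, by ring⟩,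
    fun x hx => hx⟩

/-- A subfield containing the `√p`, `p ∈ S`, need not contain any `√t` with `t ≠ 1` squarefree and
coprime to the elements of `S`. Letting `t` be a product of primes rather than a single prime is what
makes the induction on `S` work. -/
theorem exists_subfield_sqrt_mem_and_sqrt_notMem (S : Finset ℕ) (hS : ∀ p ∈ S, p.Prime) :
    ∃ K : Subfield ℝ, (∀ p ∈ S, √(p : ℝ) ∈ K) ∧
      ∀ t : ℕ, Squarefree t → t ≠ 1 → (∀ p ∈ S, ¬ p ∣ t) → √(t : ℝ) ∉ K := by
  induction S using Finset.induction_on with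
  | empty =>
    refine ⟨⊥, by simp, fun t ht ht1 _ h => ?_⟩
    obtain ⟨q, hq⟩ := (bot_le : ⊥ ≤ (algebraMap ℚ ℝ).fieldRange) h
    have hirr : Irrational √(t : ℝ) := by
      rw [irrational_sqrt_natCast_iff]
      rintro ⟨r, rfl⟩
      have := Nat.isUnit_iff.1 (ht r dvd_rfl)
      simp [this] at ht1
    exact hirr ⟨q, by simpa using hq⟩
  | insert q S hqS ih =>
    obtain ⟨K, hK, hKt⟩ := ih fun p hp => hS p (Finset.mem_insert_of_mem hp)
    have hq : q.Prime := hS q (Finset.mem_insert_self _ _)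
    have hpq : ∀ p ∈ S, ¬ p ∣ q := fun p hp h => hqS <| by
      rwa [← (Nat.prime_dvd_prime_iff_eq (hS p (Finset.mem_insert_of_mem hp)) hq).1 h]
    have hqK : √(q : ℝ) ∉ K := hKt q hq.prime.squarefree hq.ne_one hpq
    have hsq : √(q : ℝ) ^ 2 = q := Real.sq_sqrt q.cast_nonneg
    obtain ⟨L, hKL, hqL, hL⟩ := K.exists_le_quadratic (s := √(q : ℝ)) (by
      rw [hsq]; exact natCast_mem K q)
    refine ⟨L, fun p hp => ?_, fun t ht ht1 htp hmem => ?_⟩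
    · rcases Finset.mem_insert.1 hp with rfl | hp
      · exact hqL
      · exact hKL (hK p hp)
    obtain ⟨a, ha, b, hb, hab⟩ := hL _ hmem
    have hqt : ¬ q ∣ t := htp q (Finset.mem_insert_self _ _)
    have htS : ∀ p ∈ S, ¬ p ∣ t := fun p hp => htp p (Finset.mem_insert_of_mem hp)
    have hsqt : √(t : ℝ) ^ 2 = t := Real.sq_sqrt t.cast_nonneg
    -- Squaring `√t = a + b √q` gives `2 a b √q ∈ K`, so `a = 0` or `b = 0` as `√q ∉ K`.
    by_cases hb0 : b = 0
    · apply hKt t ht ht1 htS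
      rw [hab, hb0, zero_mul, add_zero]
      exact ha
    by_cases ha0 : a = 0
    · refine hKt (t * q) ?_ ?_ ?_ ?_
      · rw [Nat.squarefree_mul ((Nat.Prime.coprime_iff_not_dvd hq).2 hqt).symm]
        exact ⟨ht, hq.prime.squarefree⟩
      · intro h
        exact hq.ne_one (Nat.eq_one_of_mul_eq_one_left h)
      · intro p hp h
        rcases (hS p (Finset.mem_insert_of_mem hp)).dvd_mul.1 h with h | h
        exacts [htS p hp h, hpq p hp h]
      · have : √((t * q : ℕ) : ℝ) = b * q := by
          rw [Nat.cast_mul, Real.sqrt_mul t.cast_nonneg, hab, ha0, zero_add, mul_assoc, ← sq, hsq]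
        rw [this]
        exact K.mul_mem hb (natCast_mem K q)
    · apply hqK
      have : √(q : ℝ) = (t - a ^ 2 - b ^ 2 * q) / (2 * a * b) := by
        rw [← hsqt, hab]
        field_simp
        linear_combination (-b ^ 2) * hsq
      rw [this]
      refine K.div_mem (K.sub_mem (K.sub_mem (natCast_mem K t) (K.pow_mem ha 2))
        (K.mul_mem (K.pow_mem hb 2) (natCast_mem K q))) (K.mul_mem (K.mul_mem ?_ ha) hb)
      exact ofNat_mem K 2

theorem eq_zero_of_sum_mul_sqrt_prime_eq_zero {ι : Type*} [Fintype ι] {p : ι → ℕ}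
    (hp : ∀ i, (p i).Prime) (hinj : Function.Injective p) {n : ι → ℤ}
    (h : ∑ i, (n i : ℝ) * √(p i : ℝ) = 0) : n = 0 := by
  classical
  funext j
  by_contra hj
  obtain ⟨K, hK, hKt⟩ := exists_subfield_sqrt_mem_and_sqrt_notMem
    ((Finset.univ.erase j).image p) (by simp [hp])
  refine hKt (p j) (hp j).prime.squarefree (hp j).ne_one ?_ ?_
  · simp only [Finset.mem_image, Finset.mem_erase, Finset.mem_univ, and_true]
    rintro _ ⟨i, hij, rfl⟩ hd
    exact hij (hinj ((Nat.prime_dvd_prime_iff_eq (hp i) (hp j)).1 hd))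
  · rw [← Finset.add_sum_erase _ _ (Finset.mem_univ j)] at h
    have hj' : (n j : ℝ) ≠ 0 := by exact_mod_cast hj
    have : √(p j : ℝ) = -(∑ i ∈ Finset.univ.erase j, (n i : ℝ) * √(p i : ℝ)) / n j := by
      field_simp
      linarith
    rw [this]
    refine K.div_mem (K.neg_mem (K.sum_mem fun i hi => K.mul_mem (intCast_mem K _) ?_))
      (intCast_mem K _)
    exact hK _ (Finset.mem_image_of_mem _ hi)

/-! ### Sign-invariant polynomials -/

theorem MvPolynomial.coeff_aeval_C_mul_X {ι : Type*} [Fintype ι] (e : ι → ℤ)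
    (h : MvPolynomial ι ℤ) (m : ι →₀ ℕ) :
    (aeval (fun j => C (e j) * X j) h : MvPolynomial ι ℤ).coeff m =
      (∏ j, e j ^ m j) * h.coeff m := by
  classical
  induction h using MvPolynomial.induction_on' with
  | monomial u a =>
    have : (aeval (fun j => C (e j) * X j) (monomial u a) : MvPolynomial ι ℤ) =
        monomial u ((∏ j, e j ^ u j) * a) := by
      rw [aeval_monomial, Finsupp.prod_fintype _ _ (by simp), monomial_eq (s := u),
        Finsupp.prod_fintype _ _ (by simp)]
      simp only [mul_pow, Finset.prod_mul_distrib, algebraMap_eq, map_mul, map_prod, map_pow]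
      ring
    rw [this, coeff_monomial, coeff_monomial]
    split_ifs with hum
    · rw [hum]
    · simp
  | add p q hp hq => rw [map_add, coeff_add, coeff_add, hp, hq, mul_add]

/-- A polynomial invariant under all sign changes of the variables involves only even exponents, so
that its values at square roots of integers are integers. -/
theorem MvPolynomial.exists_aeval_eq_intCast {ι : Type*} [Fintype ι] {R : Type*} [CommRing R]
    {β : ι → R} {b : ι → ℤ} (hβ : ∀ j, β j ^ 2 = b j) {h : MvPolynomial ι ℤ}
    (hinv : ∀ ε : ι → ℤˣ, (aeval (fun j => C (ε j : ℤ) * X j) h : MvPolynomial ι ℤ) = h) :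
    ∃ z : ℤ, aeval β h = (z : R) := by
  classical
  refine ⟨∑ m ∈ h.support, h.coeff m * ∏ j, b j ^ (m j / 2), ?_⟩
  rw [aeval_def, eval₂_eq']
  push_cast
  refine Finset.sum_congr rfl fun m hm => ?_
  have heven : ∀ j, Even (m j) := by
    intro j
    by_contra hodd
    rw [Nat.not_even_iff_odd] at hodd
    have h1 := coeff_aeval_C_mul_X (fun i => ((Function.update 1 j (-1) : ι → ℤˣ) i : ℤ)) h m
    rw [hinv, Finset.prod_eq_single j] at h1
    · simp only [Function.update_self, Units.val_neg, Units.val_one, hodd.neg_one_pow] at h1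
      exact mem_support_iff.1 hm (by omega)
    · intro i _ hij
      simp [Function.update_of_ne hij]
    · simp
  congr 1
  refine Finset.prod_congr rfl fun j _ => ?_
  rw [← hβ, ← pow_mul, Nat.mul_div_cancel' (heven j).two_dvd]

/-- A sum over conjugates is an integer: replacing `β` by indeterminates turns the sum into a
sign-invariant polynomial. -/
theorem exists_sum_mul_aeval_eq_intCast {ι : Type*} [Fintype ι] {R : Type*} [CommRing R]
    {β : ι → R} {b : ι → ℤ} (hβ : ∀ j, β j ^ 2 = b j) (a : (ι → ℤ) →₀ ℤ)
    (hinv : ∀ (ε : ι → ℤˣ) n, a (ε • n) = a n) (g : Polynomial ℤ) :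
    ∃ z : ℤ, ∑ n ∈ a.support, (a n : R) * Polynomial.aeval (∑ j, (n j : R) * β j) g = z := by
  classical
  let h : MvPolynomial ι ℤ := ∑ n ∈ a.support, MvPolynomial.C (a n) *
    Polynomial.aeval (∑ j, MvPolynomial.C (n j) * MvPolynomial.X j) g
  have hh : ∀ ε : ι → ℤˣ, (MvPolynomial.aeval
      (fun j => MvPolynomial.C (ε j : ℤ) * MvPolynomial.X j) h : MvPolynomial ι ℤ) = h := by
    intro ε
    simp only [h, map_sum, map_mul, ← Polynomial.aeval_algHom_apply, MvPolynomial.aeval_X,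
      MvPolynomial.aeval_C, MvPolynomial.algebraMap_eq]
    refine Finset.sum_nbij' (fun n => ε • n) (fun n => ε⁻¹ • n) ?_ ?_ ?_ ?_ ?_
    · intro n hn
      simpa [hinv] using hn
    · intro n hn
      simpa [hinv] using hn
    · intro n _
      simp
    · intro n _
      simp
    · intro n _
      rw [hinv]
      congr 3
      refine Finset.sum_congr rfl fun j _ => ?_
      rw [Pi.smul_apply', Units.smul_def, smul_eq_mul, map_mul]
      ring
  obtain ⟨z, hz⟩ := MvPolynomial.exists_aeval_eq_intCast hβ hh
  refine ⟨z, ?_⟩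
  rw [← hz]
  simp only [h, map_sum, map_mul, ← Polynomial.aeval_algHom_apply, MvPolynomial.aeval_X,
    MvPolynomial.aeval_C]
  simp only [algebraMap_int_eq, eq_intCast]

/-! ### Linear independence of exponentials -/

open Filter Topology in
/-- The arithmetic core of the Lindemann–Weierstrass argument: a sign-invariant integer combination
of the exponentials with nonzero constant coefficient does not vanish. -/
theorem sum_mul_exp_ne_zero_of_invariant {ι : Type*} [Fintype ι] {β : ι → ℂ} {b : ι → ℤ}
    (hβ : ∀ j, β j ^ 2 = b j)
    (hind : ∀ n : ι → ℤ, ∑ j, (n j : ℂ) * β j = 0 → n = 0) (a : (ι → ℤ) →₀ ℤ)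
    (hinv : ∀ (ε : ι → ℤˣ) n, a (ε • n) = a n) (h0 : a 0 ≠ 0) :
    ∑ n ∈ a.support, (a n : ℂ) * Complex.exp (∑ j, (n j : ℂ) * β j) ≠ 0 := by
  classical
  intro hsum
  set α : (ι → ℤ) → ℂ := fun n => ∑ j, (n j : ℂ) * β j with hα
  have hα0 : α 0 = 0 := by simp [hα]
  have hint : ∀ n, IsIntegral ℤ (α n) := fun n => IsIntegral.sum _ fun j _ =>
    (isIntegral_algebraMap (R := ℤ) (A := ℂ) (x := n j)).mul <|
      IsIntegral.of_pow two_pos (by rw [hβ]; exact isIntegral_algebraMap (R := ℤ) (A := ℂ))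
  let T := a.support.erase 0
  have hT : ∀ F : (ι → ℤ) → ℂ, ∑ n ∈ a.support, (a n : ℂ) * F n =
      a 0 * F 0 + ∑ n ∈ T, (a n : ℂ) * F n := fun F =>
    (Finset.add_sum_erase _ _ (Finsupp.mem_support_iff.2 h0)).symm
  -- The auxiliary polynomial has all nonzero exponents among its roots, and `f 0 ≠ 0`.
  let f : Polynomial ℤ := ∏ n ∈ T, minpoly ℤ (α n)
  have hfmonic : f.Monic := Polynomial.monic_prod_of_monic _ _ fun n _ => minpoly.monic (hint n)
  have hf : f.eval 0 ≠ 0 := by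
    rw [Polynomial.eval_prod]
    refine Finset.prod_ne_zero_iff.2 fun n hn => ?_
    rw [← Polynomial.coeff_zero_eq_eval_zero]
    intro h
    have h' : (minpoly ℚ (α n)).coeff 0 = 0 := by
      rw [minpoly.isIntegrallyClosed_eq_field_fractions' ℚ (hint n), Polynomial.coeff_map, h,
        map_zero]
    rw [minpoly.coeff_zero_eq_zero (hint n).tower_top] at h'
    exact (Finset.mem_erase.1 hn).1 (hind n h')
  have hroot : ∀ n ∈ T, α n ∈ f.aroots ℂ := by
    intro n hn
    rw [Polynomial.mem_aroots]
    refine ⟨hfmonic.ne_zero, ?_⟩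
    rw [map_prod]
    exact Finset.prod_eq_zero hn (minpoly.aeval ℤ (α n))
  obtain ⟨c, hc⟩ := LindemannWeierstrass.exp_polynomial_approx f hf
  have hlim : Tendsto (fun p : ℕ => (∑ n ∈ T, |(a n : ℝ)|) * (c * (c ^ p / (p.factorial : ℝ))))
      atTop (𝓝 0) := by
    simpa using ((FloorSemiring.tendsto_pow_div_factorial_atTop c).const_mul c).const_mul
      (∑ n ∈ T, |(a n : ℝ)|)
  obtain ⟨M, hM⟩ := eventually_atTop.1 (hlim.eventually_lt_const one_pos)
  obtain ⟨p, hple, hp⟩ :=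
    Nat.exists_infinite_primes (M + (f.eval 0).natAbs + (a 0).natAbs + 1)
  obtain ⟨N, hN, g, -, hg⟩ := hc p (by omega) hp
  obtain ⟨z, hz⟩ := exists_sum_mul_aeval_eq_intCast hβ a hinv g
  change ∑ n ∈ a.support, (a n : ℂ) * Complex.exp (α n) = 0 at hsum
  change ∑ n ∈ a.support, (a n : ℂ) * Polynomial.aeval (α n) g = z at hz
  rw [hT (fun n => Complex.exp (α n)), hα0, Complex.exp_zero, mul_one] at hsum
  rw [hT (fun n => Polynomial.aeval (α n) g), hα0, ← Polynomial.coeff_zero_eq_aeval_zero'] at hz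
  -- Since `∑ a n * exp (α n) = 0`, the integer `w = N * a 0 + p * ∑ n ∈ T, a n * g (α n)` is small;
  -- the term `n = 0` of the integer `z` is `a 0 * g 0`.
  let w : ℤ := N * a 0 + p * (z - a 0 * g.coeff 0)
  have hw : (w : ℂ) = -∑ n ∈ T, (a n : ℂ) *
      (N • Complex.exp (α n) - p • Polynomial.aeval (α n) g) := by
    have h1 : ∑ n ∈ T, (a n : ℂ) * (N • Complex.exp (α n) - p • Polynomial.aeval (α n) g) =
        N * (∑ n ∈ T, (a n : ℂ) * Complex.exp (α n)) -
          p * ∑ n ∈ T, (a n : ℂ) * Polynomial.aeval (α n) g := by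
      rw [Finset.mul_sum, Finset.mul_sum, ← Finset.sum_sub_distrib]
      refine Finset.sum_congr rfl fun n _ => ?_
      simp only [zsmul_eq_mul, nsmul_eq_mul]
      ring
    rw [h1]
    simp only [algebraMap_int_eq, eq_intCast] at hz
    simp only [w]
    push_cast
    linear_combination (N : ℂ) * hsum - (p : ℂ) * hz
  have hbound : ‖(w : ℂ)‖ < 1 := by
    have hle : ‖(w : ℂ)‖ ≤ ∑ n ∈ T, |(a n : ℝ)| * (c ^ p / ((p - 1).factorial : ℝ)) := by
      rw [hw, norm_neg]
      refine (norm_sum_le _ _).trans (Finset.sum_le_sum fun n hn => ?_)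
      rw [norm_mul, Complex.norm_intCast]
      exact mul_le_mul_of_nonneg_left (hg (hroot n hn)) (abs_nonneg _)
    refine hle.trans_lt ?_
    rw [← Finset.sum_mul]
    have h2 := hM (p - 1) (by omega)
    rwa [← mul_div_assoc, ← pow_succ', Nat.sub_add_cancel hp.one_le] at h2
  have hw0 : w = 0 := by
    rw [Complex.norm_intCast] at hbound
    exact Int.abs_lt_one_iff.1 (by exact_mod_cast hbound)
  have hdvd : (p : ℤ) ∣ N * a 0 :=
    (Int.dvd_add_left (Dvd.intro _ rfl)).1 (hw0 ▸ dvd_zero (p : ℤ) : (p : ℤ) ∣ w)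
  rcases (Nat.prime_iff_prime_int.1 hp).dvd_or_dvd hdvd with h | h
  · exact hN h
  · have := Int.natAbs_dvd_natAbs.2 h
    have := Nat.le_of_dvd (Int.natAbs_pos.2 h0) this
    simp only [Int.natAbs_natCast] at this
    omega

/-- The exponentials `exp (∑ j, n j * β j)`, `n ∈ ℤ^ι`, are linearly independent over `ℤ` when
the `β j` are linearly independent square roots of integers. -/
theorem eq_zero_of_sum_mul_exp_eq_zero {ι : Type*} [Fintype ι] {β : ι → ℂ} {b : ι → ℤ}
    (hβ : ∀ j, β j ^ 2 = b j)
    (hind : ∀ n : ι → ℤ, ∑ j, (n j : ℂ) * β j = 0 → n = 0) (a : (ι → ℤ) →₀ ℤ)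
    (h : ∑ n ∈ a.support, (a n : ℂ) * Complex.exp (∑ j, (n j : ℂ) * β j) = 0) : a = 0 := by
  classical
  let E : Multiplicative (ι → ℤ) →* ℂ :=
    { toFun := fun n => Complex.exp (∑ j, (n.toAdd j : ℂ) * β j)
      map_one' := by simp
      map_mul' := fun m n => by
        simp [add_mul, Finset.sum_add_distrib, Complex.exp_add] }
  let ev := AddMonoidAlgebra.lift ℤ ℂ (ι → ℤ) E
  have hev : ∀ x : AddMonoidAlgebra ℤ (ι → ℤ), ev x =
      ∑ n ∈ x.coeff.support, (x.coeff n : ℂ) * Complex.exp (∑ j, (n j : ℂ) * β j) := by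
    intro x
    simp [ev, AddMonoidAlgebra.lift_apply, Finsupp.sum, E]
  by_contra ha
  let A : AddMonoidAlgebra ℤ (ι → ℤ) := .ofCoeff a
  have hA : A ≠ 0 := fun h => ha (congrArg AddMonoidAlgebra.coeff h)
  let act (ε : ι → ℤˣ) : AddMonoidAlgebra ℤ (ι → ℤ) →+* AddMonoidAlgebra ℤ (ι → ℤ) :=
    AddMonoidAlgebra.mapDomainRingHom ℤ (DistribSMul.toAddMonoidHom (ι → ℤ) ε)
  have hact_inj : ∀ ε, Function.Injective (act ε) := fun ε =>
    AddMonoidAlgebra.mapDomain_injective (MulAction.injective ε)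
  have hact_mul : ∀ ε δ x, act ε (act δ x) = act (ε * δ) x := by
    intro ε δ x
    have : (act ε).comp (act δ) = act (ε * δ) := by
      rw [← AddMonoidAlgebra.mapDomainRingHom_comp]
      congr 1
      exact AddMonoidHom.ext fun n => smul_smul ε δ n
    exact DFunLike.congr_fun this x
  have hact_one : act 1 A = A := by
    have : DistribSMul.toAddMonoidHom (ι → ℤ) (1 : ι → ℤˣ) = AddMonoidHom.id _ :=
      AddMonoidHom.ext (one_smul _)
    simp [act, this]
  have hact_coeff : ∀ ε x n, (act ε x).coeff (ε • n) = x.coeff n := by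
    intro ε x n
    simp only [act, AddMonoidAlgebra.mapDomainRingHom_apply, AddMonoidAlgebra.coeff_mapDomain]
    exact Finsupp.mapDomain_apply (MulAction.injective ε) _ _
  -- The norm of `A` under the group of sign changes; `F * F` is a relation as well.
  let F := ∏ ε, act ε A
  have hF0 : F ≠ 0 := Finset.prod_ne_zero_iff.2 fun ε _ h =>
    hA (hact_inj ε (h.trans (map_zero _).symm))
  have hFinv : ∀ ε, act ε F = F := by
    intro ε
    simp only [F, map_prod, hact_mul]
    exact Fintype.prod_equiv (Equiv.mulLeft ε) _ _ fun _ => rfl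
  have hFev : ev F = 0 := by
    simp only [F, map_prod]
    refine Finset.prod_eq_zero (Finset.mem_univ 1) ?_
    rw [hact_one, hev]
    exact h
  have hcoeff : ∀ x, (∀ ε, act ε x = x) → ∀ (ε : ι → ℤˣ) n, x.coeff (ε • n) = x.coeff n := by
    intro x hx ε n
    conv_lhs => rw [← hx ε]
    exact hact_coeff ε x n
  have hneg : ∀ n, F.coeff (-n) = F.coeff n := by
    intro n
    rw [← hcoeff F hFinv (fun _ => -1) n]
    congr 1
    ext j
    simp
  have hpos : (F * F).coeff 0 ≠ 0 := by
    rw [AddMonoidAlgebra.coeff_mul]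
    have hsq : (F.coeff.sum fun m r => F.coeff.sum fun n s => if m + n = 0 then r * s else 0) =
        ∑ m ∈ F.coeff.support, F.coeff m ^ 2 := by
      refine Finset.sum_congr rfl fun m _ => ?_
      refine (Finset.sum_eq_single (-m) (fun n _ hn => ?_) fun h => ?_).trans ?_
      · exact if_neg fun h => hn (eq_neg_of_add_eq_zero_right h)
      · simp [Finsupp.notMem_support_iff.1 h]
      · simp [hneg, sq]
    rw [hsq]
    have hF : F.coeff.support.Nonempty := by
      rw [Finsupp.support_nonempty_iff]
      exact fun h => hF0 (AddMonoidAlgebra.coeff_injective h)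
    exact (Finset.sum_pos (fun m hm => sq_pos_of_ne_zero (Finsupp.mem_support_iff.1 hm)) hF).ne'
  refine sum_mul_exp_ne_zero_of_invariant hβ hind (F * F).coeff
    (hcoeff _ fun ε => by rw [map_mul, hFinv]) hpos ?_
  rw [← hev, map_mul, hFev, zero_mul]

theorem eq_of_sum_exp_eq {ι : Type*} [Fintype ι] {β : ι → ℂ} {b : ι → ℤ}
    (hβ : ∀ j, β j ^ 2 = b j)
    (hind : ∀ n : ι → ℤ, ∑ j, (n j : ℂ) * β j = 0 → n = 0) {A B : Finset (ι → ℤ)}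
    (h : ∑ n ∈ A, Complex.exp (∑ j, (n j : ℂ) * β j) =
      ∑ n ∈ B, Complex.exp (∑ j, (n j : ℂ) * β j)) : A = B := by
  classical
  let ind (S : Finset (ι → ℤ)) : (ι → ℤ) →₀ ℤ := Finsupp.indicator S fun _ _ => 1
  have hind_apply : ∀ S n, ind S n = if n ∈ S then 1 else 0 := fun S n => by
    simp [ind, Finsupp.indicator_apply]
  have hsum : ∀ (S T : Finset (ι → ℤ)) (F : (ι → ℤ) → ℂ), S ⊆ T →
      ∑ n ∈ S, F n = ∑ n ∈ T, (ind S n : ℂ) * F n := by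
    intro S T F hST
    simp only [hind_apply, Int.cast_ite, Int.cast_one, Int.cast_zero, ite_mul, one_mul, zero_mul,
      Finset.sum_ite_mem, Finset.inter_eq_right.2 hST]
  have hzero : ind A - ind B = 0 := by
    refine eq_zero_of_sum_mul_exp_eq_zero hβ hind _ ?_
    rw [Finset.sum_subset (s₂ := A ∪ B)]
    · simp only [Finsupp.sub_apply, Int.cast_sub, sub_mul, Finset.sum_sub_distrib]
      rw [← hsum A _ _ Finset.subset_union_left, ← hsum B _ _ Finset.subset_union_right]
      exact sub_eq_zero.2 h
    · intro n hn
      by_contra h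
      rw [Finset.mem_union, not_or] at h
      simp [hind_apply, h.1, h.2] at hn
    · intro n _ hn
      rw [Finsupp.notMem_support_iff.1 hn, Int.cast_zero, zero_mul]
  ext n
  have hn := DFunLike.congr_fun (sub_eq_zero.1 hzero) n
  rw [hind_apply, hind_apply] at hn
  by_cases hA : n ∈ A <;> by_cases hB : n ∈ B <;> simp [hA, hB] at hn ⊢

/-! ### Integer point transforms at `ξ*` -/

theorem IntegerPoint.two_pi_I_mul_inner_xiStar {d : ℕ} (n : Fin d → ℤ) :
    2 * Real.pi * Complex.I * ((inner ℝ (toReal n) (xiStar d) : ℝ) : ℂ) =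
      ∑ j, (n j : ℂ) * (2 * Complex.I * (√(Nat.nth Nat.Prime j : ℝ) : ℂ)) := by
  have hpi : (Real.pi : ℂ) ≠ 0 := Complex.ofReal_ne_zero.2 Real.pi_ne_zero
  simp only [toReal, xiStar, PiLp.inner_apply, PiLp.smul_apply, smul_eq_mul,
    RCLike.inner_apply, conj_trivial, Complex.ofReal_sum, Finset.mul_sum]
  refine Finset.sum_congr rfl fun j _ => ?_
  push_cast
  field_simp

theorem IntegerPoint.sigma_xiStar_injective (d : ℕ) :
    Function.Injective fun A : Finset (Fin d → ℤ) => sigma A (xiStar d) := by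
  intro A B hAB
  simp only [sigma, two_pi_I_mul_inner_xiStar] at hAB
  refine eq_of_sum_exp_eq (β := fun j : Fin d => 2 * Complex.I * (√(Nat.nth Nat.Prime j : ℝ) : ℂ))
    (b := fun j => -4 * (Nat.nth Nat.Prime j : ℤ)) (fun j => ?_)
    (fun n hn => ?_) hAB
  · rw [mul_pow, mul_pow, Complex.I_sq, ← Complex.ofReal_pow, Real.sq_sqrt (Nat.cast_nonneg _)]
    push_cast
    ring
  · refine eq_zero_of_sum_mul_sqrt_prime_eq_zero (p := fun j : Fin d => Nat.nth Nat.Prime j)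
      (fun j => Nat.prime_nth_prime j)
      (fun i j h => Fin.ext (Nat.nth_injective Nat.infinite_setOfPred_prime h)) ?_
    have h : 2 * Complex.I * ((∑ j, (n j : ℝ) * √(Nat.nth Nat.Prime j : ℝ) : ℝ) : ℂ) = 0 := by
      rw [← hn, Complex.ofReal_sum, Finset.mul_sum]
      refine Finset.sum_congr rfl fun j _ => ?_
      push_cast
      ring
    exact Complex.ofReal_eq_zero.1
      ((mul_eq_zero.1 h).resolve_left (mul_ne_zero two_ne_zero Complex.I_ne_zero))

theorem IntegerPoint.IsPolytope.sigmaPolytope_eq {d : ℕ} {P : Set (EuclideanSpace ℝ (Fin d))}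
    (hP : IsPolytope P) (ξ : EuclideanSpace ℝ (Fin d)) :
    sigmaPolytope P ξ = sigma hP.finite_integerPoints.toFinset ξ :=
  finsum_mem_eq_finite_toFinset_sum _ hP.finite_integerPoints

/-- By Krein–Milman, `P` is the closed convex hull of its vertices, which are integer points. -/
theorem IntegerPoint.IsIntegerPolytope.subset_of_integerPoints_subset {d : ℕ}
    {P Q : Set (EuclideanSpace ℝ (Fin d))} (hP : IsIntegerPolytope P) (hQ : IsPolytope Q)
    (h : integerPoints P ⊆ integerPoints Q) : P ⊆ Q := by
  obtain ⟨⟨s, rfl⟩, hv⟩ := hP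
  obtain ⟨t, rfl⟩ := hQ
  rw [← closure_convexHull_extremePoints (s.finite_toSet.isCompact_convexHull ℝ)
    (convex_convexHull ℝ _)]
  refine closure_minimal (convexHull_min (fun v hvP => ?_) (convex_convexHull ℝ _))
    (t.finite_toSet.isClosed_convexHull ℝ)
  choose m hm using hv v hvP
  have hvm : toReal m = v := by
    ext i
    exact (hm i).symm
  have : m ∈ integerPoints (convexHull ℝ (s : Set (EuclideanSpace ℝ (Fin d)))) := by
    rw [integerPoints, Set.mem_ofPred_eq, hvm]
    exact extremePoints_subset hvP
  rw [← hvm]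
  exact h this

theorem IntegerPoint.sigmaPolytope_xiStar_eq_iff {d : ℕ} {P Q : Set (EuclideanSpace ℝ (Fin d))}
    (hP : IsIntegerPolytope P) (hQ : IsIntegerPolytope Q) :
    sigmaPolytope P (xiStar d) = sigmaPolytope Q (xiStar d) ↔ P = Q := by
  refine ⟨fun h => ?_, fun h => by rw [h]⟩
  rw [hP.1.sigmaPolytope_eq, hQ.1.sigmaPolytope_eq] at h
  have hPQ := Set.Finite.toFinset_inj.1 (sigma_xiStar_injective d h)
  exact (hP.subset_of_integerPoints_subset hQ.1 hPQ.subset).antisymm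
    (hQ.subset_of_integerPoints_subset hP.1 hPQ.superset)

theorem theorem1 (d : ℕ) :
    (∀ A B : Finset (Fin d → ℤ),
      IntegerPoint.sigma A (IntegerPoint.xiStar d) = IntegerPoint.sigma B (IntegerPoint.xiStar d) ↔
        A = B) ∧
    (∀ P Q : Set (EuclideanSpace ℝ (Fin d)),
      IntegerPoint.IsIntegerPolytope P → IntegerPoint.IsIntegerPolytope Q →
        (IntegerPoint.sigmaPolytope P (IntegerPoint.xiStar d) =
          IntegerPoint.sigmaPolytope Q (IntegerPoint.xiStar d) ↔ P = Q)) ∧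
    (∀ P Q : Set (EuclideanSpace ℝ (Fin d)),
      IntegerPoint.IsRationalPolytope P → IntegerPoint.IsRationalPolytope Q →
        ∀ k : ℕ, 0 < k →
          IntegerPoint.IsIntegerPolytope ((k : ℝ) • P) →
          IntegerPoint.IsIntegerPolytope ((k : ℝ) • Q) →
          (IntegerPoint.sigmaPolytope ((k : ℝ) • P) (IntegerPoint.xiStar d) =
            IntegerPoint.sigmaPolytope ((k : ℝ) • Q) (IntegerPoint.xiStar d) ↔ P = Q)) := by
  refine ⟨fun A B => (IntegerPoint.sigma_xiStar_injective d).eq_iff,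
    fun P Q hP hQ => IntegerPoint.sigmaPolytope_xiStar_eq_iff hP hQ,
    fun P Q _ _ k hk hP hQ => ?_⟩
  rw [IntegerPoint.sigmaPolytope_xiStar_eq_iff hP hQ]
  exact (MulAction.injective₀ (Nat.cast_ne_zero.2 hk.ne')).eq_iff
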